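/- For each integer $s\ge 2$ put $$c_s:=\prod_{j=1}^{s}\left(\frac{(j-1)^{2(j-1)}\,j^{j}}{(s+j-2)^{s+j-2}}\right)^{\frac{1}{s(s-1)}}$$ (with $0^0=1$), and put $c_0=c_1:=1$. Let $\mathcal S$ be a set of integers contained in an interval $[N,N+M]$, where $N,M$ are real and $M>0$, and let $S:=\#\mathcal S$. Let $\mathcal Q$ be a finite set of pairwise coprime positive integers and, for each $q\in\mathcal Q$, let $\nu(q)$ be an integer with $1\le\nu(q)\le q$ such that the elements of $\mathcal S$ belong to at most $\nu(q)$ congruence classes modulo $q$. If $$\sum_{q\in\mathcal Q}\frac{\log q}{\nu(q)}-\log(c_S M)>0,$$ then $$S\le\frac{\sum_{q\in\mathcal Q}\log q-\log(c_S M)}{\sum_{q\in\mathcal Q}\frac{\log q}{\nu(q)}-\log(c_S M)}.$$ -/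

import Mathlib

/-- The constant `c_s = ∏_{j=1}^{s} ((j-1)^{2(j-1)} j^j / (s+j-2)^{s+j-2})^{1/(s(s-1))}`
for `s ≥ 2`, with `0 ^ 0 = 1` in the factor `j = 1`. For `s ≤ 1` the value is `1`. -/
noncomputable def sieveConst (s : ℕ) : ℝ :=
  ∏ j ∈ Finset.Icc 1 s,
    ((((j - 1 : ℕ) : ℝ) ^ (2 * (j - 1)) * (j : ℝ) ^ j) /
        ((s + j - 2 : ℕ) : ℝ) ^ (s + j - 2)) ^ (1 / ((s : ℝ) * ((s : ℝ) - 1)))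

/-!
The proof combines Gallagher's larger sieve with the sharp bound for the discriminant of `s` points
of an interval.

*Discriminant.* Let `Y` be a set of `m` points of `[0, 1]`, let `p = ∏ (t - y)`, and let `X` be the
set of roots of `p'`. Computing the resultant of `p` and `p'` in two ways gives
`pairProd Y = m ^ m * ∏ |p x|`. On the other hand the residues of `p / (t (t - 1) ∏ (t - x))` at
`0`, `1` and the points of `X` sum to `1` (`sum_residues_eq_one`), and they are nonnegative, since
`p p'' ≤ 0` at a critical point of a real-rooted polynomial. The weighted arithmetic-geometric mean
inequality, with weight `a` at `0` and `1` and weight `1` at each `x`, bounds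
`(∏ y (1 - y)) ^ a * pairProd Y` by a constant times `(∏ x (1 - x)) ^ (a + 1) * pairProd X`
(`exists_pairProd_le`). Starting at `a = 0` and descending until no points are left, the constants
multiply to `c_s ^ (s (s - 1))` (`pairProd_le_sieveConst_pow`). After rescaling,
`∑_{m ≠ n} log |m - n| ≤ s (s - 1) log (c_s M)` for the elements of `S` (`sum_log_abs_sub_le`).

*Sieve.* By Cauchy-Schwarz there are at least `s ^ 2 / ν(q) - s` ordered pairs of distinct elements
of `S` that are congruent modulo `q`, and by coprimality `m - n` is divisible by the product of all
`q` with `m ≡ n` modulo `q`. Hence `∑ log q * (s ^ 2 / ν(q) - s)` is at most the same sum of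
logarithms (`sum_log_mul_le_sum_log_abs_sub`). Comparing the two bounds gives the result; for
`s ≤ 1` it is immediate.
-/

open Polynomial Lagrange Finset

/-! ### Critical points of a real-rooted polynomial -/

/-- The product `∏_{y ≠ z} |y - z|` over ordered pairs of distinct points of `Y`, that is, the
absolute value of the discriminant of `∏_{y ∈ Y} (t - y)`. -/
noncomputable def pairProd (Y : Finset ℝ) : ℝ := ∏ y ∈ Y, ∏ z ∈ Y.erase y, |y - z|

theorem pairProd_pos (Y : Finset ℝ) : 0 < pairProd Y :=
  prod_pos fun _ _ => prod_pos fun _ hz => abs_pos.2 (sub_ne_zero.2 (ne_of_mem_erase hz).symm)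

/-- By Rolle's theorem the derivative of a polynomial with distinct real roots again has distinct
real roots. -/
theorem exists_derivative_nodal_eq (Y : Finset ℝ) (hY : Y.Nonempty) :
    ∃ X : Finset ℝ, #X + 1 = #Y ∧ derivative (nodal Y id) = C (#Y : ℝ) * nodal X id := by
  set p : ℝ[X] := nodal Y id with hp
  have hp0 : p ≠ 0 := nodal_ne_zero
  have hdeg : p.natDegree = #Y := natDegree_nodal
  have hcard : 0 < #Y := hY.card_pos
  have hd : p.derivative.natDegree = #Y - 1 := by rw [natDegree_derivative, hdeg]
  have hroots : p.roots.toFinset = Y := by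
    ext t
    rw [Multiset.mem_toFinset, mem_roots hp0]
    simp [hp, eval_nodal, prod_eq_zero_iff, sub_eq_zero]
  have hRolle := card_roots_toFinset_le_derivative p
  rw [hroots] at hRolle
  have h1 : #p.derivative.roots.toFinset ≤ Multiset.card p.derivative.roots :=
    Multiset.toFinset_card_le _
  have h2 := card_roots' p.derivative
  have h3 : Multiset.card p.derivative.roots = p.derivative.natDegree := by omega
  have hnd : p.derivative.roots.Nodup := by
    rw [← Multiset.toFinset_card_eq_card_iff_nodup]; omega
  refine ⟨p.derivative.roots.toFinset, by omega, ?_⟩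
  have h4 := C_leadingCoeff_mul_prod_multiset_X_sub_C h3
  have h5 : p.derivative.leadingCoeff = #Y := by
    have : p.coeff #Y = 1 := by
      have := (nodal_monic : (nodal Y (id : ℝ → ℝ)).Monic)
      rw [Monic, leadingCoeff, ← hp, hdeg] at this
      exact this
    rw [leadingCoeff, hd, coeff_derivative, Nat.sub_add_cancel hcard, this, Nat.cast_sub hcard]
    simp
  rw [h5] at h4
  refine h4.symm.trans ?_
  congr 1
  rw [nodal, Finset.prod, Multiset.toFinset_val, hnd.dedup]
  simp

/-- The Laguerre inequality `p p'' ≤ p'^2` for a polynomial with only real roots. -/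
theorem eval_nodal_mul_derivative_derivative_le (Y : Finset ℝ) (t : ℝ) :
    (nodal Y id).eval t * (derivative (derivative (nodal Y id))).eval t ≤
      ((derivative (nodal Y id)).eval t) ^ 2 := by
  induction Y using Finset.induction_on with
  | empty => simp
  | insert y Y hy ih =>
    rw [nodal_insert_eq_nodal hy]
    simp only [derivative_mul, derivative_sub, derivative_X, derivative_C, derivative_add, eval_add,
      eval_mul, eval_sub, eval_X, eval_C, eval_one, sub_zero, zero_mul, zero_add,
      derivative_one, id]
    nlinarith [mul_le_mul_of_nonneg_left ih (sq_nonneg (t - y)), sq_nonneg (eval t (nodal Y id))]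

theorem eval_derivative_nodal_eq_mul_sum (Y : Finset ℝ) (t : ℝ) (ht : t ∉ Y) :
    (derivative (nodal Y id)).eval t = (nodal Y id).eval t * ∑ y ∈ Y, 1 / (t - y) := by
  rw [derivative_nodal, eval_finsetSum, mul_sum]
  refine sum_congr rfl fun y hy => ?_
  have h : t - y ≠ 0 := sub_ne_zero.2 fun h => ht (h ▸ hy)
  rw [eval_nodal, eval_nodal, ← mul_prod_erase _ _ hy]
  simp only [id]
  field_simp

theorem eval_derivative_nodal_of_mem (Y : Finset ℝ) {y : ℝ} (hy : y ∈ Y) :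
    (derivative (nodal Y id)).eval y = ∏ z ∈ Y.erase y, (y - z) := by
  have := eval_nodal_derivative_eval_node_eq (v := (id : ℝ → ℝ)) hy
  simpa [eval_nodal] using this

/-! ### A weighted mean inequality -/

/-- One factor of the weighted arithmetic-geometric mean inequality. -/
theorem mul_pow_le_pow_mul_exp {w S : ℝ} (hw : 0 ≤ w) (hS : 0 ≤ S) (a : ℕ) :
    (w * S) ^ a ≤ (a : ℝ) ^ a * Real.exp (S * w - a) := by
  rcases Nat.eq_zero_or_pos a with rfl | ha
  · simpa using mul_nonneg hS hw
  · have ha' : (0 : ℝ) < a := by exact_mod_cast ha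
    have h : w * S ≤ a * Real.exp (w * S / a - 1) := by
      have := Real.add_one_le_exp (w * S / a - 1)
      rw [sub_add_cancel, div_le_iff₀ ha'] at this
      linarith
    calc (w * S) ^ a ≤ (a * Real.exp (w * S / a - 1)) ^ a :=
          pow_le_pow_left₀ (mul_nonneg hw hS) h a
      _ = _ := by
          rw [mul_pow, ← Real.exp_nat_mul]
          congr 2
          field_simp

/-- Weighted arithmetic-geometric mean inequality for weights summing to `1`, two of which have
multiplicity `a` and the others multiplicity `1`; `a = 0` is allowed. -/
theorem weighted_mean_le (X : Finset ℝ) (W : ℝ → ℝ) (u v : ℝ) (a : ℕ) (hu : 0 ≤ u) (hv : 0 ≤ v)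
    (hW : ∀ x ∈ X, 0 ≤ W x) (hsum : u + (v + ∑ x ∈ X, W x) = 1) :
    u ^ a * v ^ a * (∏ x ∈ X, W x) * ((2 * a + #X : ℕ) : ℝ) ^ (2 * a + #X) ≤
      (a : ℝ) ^ (2 * a) := by
  set S : ℝ := ((2 * a + #X : ℕ) : ℝ) with hS
  have hS0 : 0 ≤ S := Nat.cast_nonneg _
  have h1 := mul_pow_le_pow_mul_exp hu hS0 a
  have h2 := mul_pow_le_pow_mul_exp hv hS0 a
  have h3 : ∏ x ∈ X, (W x * S) ≤ ∏ x ∈ X, Real.exp (S * W x - 1) := by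
    refine prod_le_prod (fun x hx => mul_nonneg (hW x hx) hS0) fun x hx => ?_
    simpa using mul_pow_le_pow_mul_exp (hW x hx) hS0 1
  rw [← Real.exp_sum] at h3
  have hexp : Real.exp (S * u - a) * Real.exp (S * v - a) *
      Real.exp (∑ x ∈ X, (S * W x - 1)) = 1 := by
    rw [← Real.exp_add, ← Real.exp_add, Real.exp_eq_one_iff, sum_sub_distrib, ← mul_sum]
    have : S = 2 * a + #X := by rw [hS]; push_cast; ring
    simp only [sum_const, nsmul_eq_mul, mul_one]
    linear_combination S * hsum + this
  have h0 : 0 ≤ ∏ x ∈ X, (W x * S) := prod_nonneg fun x hx => mul_nonneg (hW x hx) hS0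
  calc _ = (u * S) ^ a * (v * S) ^ a * ∏ x ∈ X, (W x * S) := by
        rw [prod_mul_distrib, prod_const]; ring
    _ ≤ ((a : ℝ) ^ a * Real.exp (S * u - a)) * ((a : ℝ) ^ a * Real.exp (S * v - a)) *
        Real.exp (∑ x ∈ X, (S * W x - 1)) := by gcongr
    _ = (a : ℝ) ^ (2 * a) * (Real.exp (S * u - a) * Real.exp (S * v - a) *
        Real.exp (∑ x ∈ X, (S * W x - 1))) := by ring
    _ = _ := by rw [hexp, mul_one]

/-! ### The discriminant of points in the unit interval -/

theorem prod_prod_abs_sub_eq (X Y : Finset ℝ) :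
    ∏ y ∈ Y, |(nodal X id).eval y| = ∏ x ∈ X, |(nodal Y id).eval x| := by
  simp only [eval_nodal, abs_prod, id]
  rw [prod_comm]
  simp only [abs_sub_comm]

/-- The discriminant of `p = ∏ (t - y)` in terms of the resultant of `p` and `p'`. -/
theorem pairProd_eq_of_derivative {X Y : Finset ℝ}
    (h : derivative (nodal Y id) = C (#Y : ℝ) * nodal X id) :
    pairProd Y = (#Y : ℝ) ^ #Y * ∏ x ∈ X, |(nodal Y id).eval x| := by
  rw [← prod_prod_abs_sub_eq, ← prod_const, ← prod_mul_distrib, pairProd]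
  refine prod_congr rfl fun y hy => ?_
  rw [← abs_prod, ← eval_derivative_nodal_of_mem Y hy, h, eval_mul, eval_C, abs_mul, Nat.abs_cast]

/-- The critical points are strictly inside the interval: for `x` outside `(0, 1)` the terms of
`p' / p = ∑ 1 / (x - y)` all have the same sign. -/
theorem critical_point_mem {X Y : Finset ℝ} (hY : Y.Nonempty) (hI : ∀ y ∈ Y, y ∈ Set.Icc (0 : ℝ) 1)
    (h : derivative (nodal Y id) = C (#Y : ℝ) * nodal X id) {x : ℝ} (hx : x ∈ X) :
    x ∈ Set.Ioo (0 : ℝ) 1 := by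
  have h0 : (derivative (nodal Y id)).eval x = 0 := by
    rw [h, eval_mul]
    have : eval x (nodal X id) = 0 := eval_nodal_at_node (v := id) hx
    rw [this, mul_zero]
  have hxY : x ∉ Y := fun hxY => by
    rw [eval_derivative_nodal_of_mem Y hxY, prod_eq_zero_iff] at h0
    obtain ⟨z, hz, hz'⟩ := h0
    exact ne_of_mem_erase hz (sub_eq_zero.1 hz').symm
  have hne : ∀ y ∈ Y, x ≠ y := fun y hy e => hxY (e ▸ hy)
  have hp : (nodal Y id).eval x ≠ 0 := by
    rw [eval_nodal]
    exact prod_ne_zero_iff.2 fun y hy => sub_ne_zero.2 (hne y hy)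
  have hs : ∑ y ∈ Y, 1 / (x - y) = 0 := by
    rw [eval_derivative_nodal_eq_mul_sum Y x hxY] at h0
    exact (mul_eq_zero.1 h0).resolve_left hp
  constructor <;> by_contra! hc
  · refine (sum_neg (fun y hy => one_div_neg.2 (sub_neg.2 ?_)) hY).ne hs
    exact lt_of_le_of_ne (hc.trans (hI y hy).1) (hne y hy)
  · refine (sum_pos (fun y hy => one_div_pos.2 (sub_pos.2 ?_)) hY).ne' hs
    exact lt_of_le_of_ne ((hI y hy).2.trans hc) (hne y hy).symm

/-- The residues of `∏ (t - y) / (t (t - 1) ∏ (t - x))` sum to `1`. -/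
theorem sum_residues_eq_one {X Y : Finset ℝ} (hcard : #X + 1 = #Y)
    (hX : ∀ x ∈ X, x ∈ Set.Ioo (0 : ℝ) 1) :
    (∏ y ∈ Y, y) / (∏ x ∈ X, x) + ((∏ y ∈ Y, (1 - y)) / (∏ x ∈ X, (1 - x)) +
      ∑ x ∈ X, (nodal Y id).eval x / (x * (x - 1) * ∏ z ∈ X.erase x, (x - z))) = 1 := by
  have h0 : (0 : ℝ) ∉ X := fun h => (hX 0 h).1.false
  have h1 : (1 : ℝ) ∉ X := fun h => (hX 1 h).2.false
  have h01 : (0 : ℝ) ∉ insert (1 : ℝ) X := by simp [h0]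
  have hdeg : (nodal Y (id : ℝ → ℝ)).degree = #Y := degree_nodal
  have key := leadingCoeff_eq_sum (s := insert (0 : ℝ) (insert 1 X)) (v := id)
    (Set.injOn_id _) (P := nodal Y id) (by
      rw [hdeg, card_insert_of_notMem h01, card_insert_of_notMem h1, hcard]; norm_cast)
  rw [(nodal_monic : (nodal Y (id : ℝ → ℝ)).Monic).leadingCoeff, sum_insert h01,
    sum_insert h1] at key
  refine Eq.trans ?_ key.symm
  congr 1
  · rw [erase_insert h01, prod_insert h1, eval_nodal]
    have hneg (T : Finset ℝ) : ∏ t ∈ T, -t = (-1) ^ #T * ∏ t ∈ T, t := prod_neg _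
    simp only [id, zero_sub]
    rw [hneg, hneg, ← hcard, pow_succ, neg_one_mul, mul_neg_one, neg_mul,
      neg_div_neg_eq, mul_div_mul_left]
    exact pow_ne_zero _ (by norm_num)
  congr 1
  · rw [insert_comm, erase_insert (by simp [h1]), prod_insert h0, eval_nodal]
    simp
  · refine sum_congr rfl fun x hx => ?_
    have hx0 : (0 : ℝ) ≠ x := fun h => h0 (h ▸ hx)
    have hx1 : (1 : ℝ) ≠ x := fun h => h1 (h ▸ hx)
    rw [erase_insert_of_ne hx0, erase_insert_of_ne hx1, prod_insert, prod_insert]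
    · simp [mul_assoc]
    · exact fun h => h1 (mem_of_mem_erase h)
    · simp [h0]

/-- Passing from a set `Y` to its critical points `X` lowers the number of points by one, at the
cost of one more factor `x (1 - x)` for each point. -/
theorem exists_pairProd_le (Y : Finset ℝ) (hY : Y.Nonempty) (hI : ∀ y ∈ Y, y ∈ Set.Icc (0 : ℝ) 1)
    (a : ℕ) :
    ∃ X : Finset ℝ, #X + 1 = #Y ∧ (∀ x ∈ X, x ∈ Set.Icc (0 : ℝ) 1) ∧
      (∏ y ∈ Y, y * (1 - y)) ^ a * pairProd Y * ((2 * a + #X : ℕ) : ℝ) ^ (2 * a + #X) ≤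
        (#Y : ℝ) ^ #Y * (a : ℝ) ^ (2 * a) * ((∏ x ∈ X, x * (1 - x)) ^ (a + 1) * pairProd X) := by
  obtain ⟨X, hcard, hder⟩ := exists_derivative_nodal_eq Y hY
  have hX : ∀ x ∈ X, x ∈ Set.Ioo (0 : ℝ) 1 := fun x hx => critical_point_mem hY hI hder hx
  refine ⟨X, hcard, fun x hx => Set.Ioo_subset_Icc_self (hX x hx), ?_⟩
  set W : ℝ → ℝ :=
    fun x => (nodal Y id).eval x / (x * (x - 1) * ∏ z ∈ X.erase x, (x - z)) with hWdef
  have hYpos : (0 : ℝ) < #Y := by exact_mod_cast hY.card_pos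
  have hA : 0 < ∏ x ∈ X, x := prod_pos fun x hx => (hX x hx).1
  have hB : 0 < ∏ x ∈ X, (1 - x) := prod_pos fun x hx => sub_pos.2 (hX x hx).2
  have hA' : 0 ≤ ∏ y ∈ Y, y := prod_nonneg fun y hy => (hI y hy).1
  have hB' : 0 ≤ ∏ y ∈ Y, (1 - y) := prod_nonneg fun y hy => sub_nonneg.2 (hI y hy).2
  have hW : ∀ x ∈ X, 0 ≤ W x := by
    intro x hx
    -- at a critical point of a real-rooted `p` the Laguerre inequality gives `p p'' ≤ 0`
    have hL := eval_nodal_mul_derivative_derivative_le Y x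
    have hx0 : eval x (nodal X id) = 0 := eval_nodal_at_node (v := id) hx
    rw [hder, derivative_C_mul, eval_C_mul, eval_C_mul, hx0,
      eval_derivative_nodal_of_mem X hx] at hL
    have hL' : (nodal Y id).eval x * ∏ z ∈ X.erase x, (x - z) ≤ 0 := by
      by_contra! hc
      nlinarith [mul_pos hYpos hc]
    obtain ⟨h1, h2⟩ := hX x hx
    have h3 : x * (x - 1) ≤ 0 := by nlinarith
    rw [hWdef]
    dsimp only
    have hne : ∏ z ∈ X.erase x, (x - z) ≠ 0 :=
      prod_ne_zero_iff.2 fun z hz => sub_ne_zero.2 (ne_of_mem_erase hz).symm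
    rw [← mul_div_mul_right _ _ hne]
    refine div_nonneg_of_nonpos hL' ?_
    rw [mul_assoc]
    exact mul_nonpos_of_nonpos_of_nonneg h3 (mul_self_nonneg _)
  have hsum := sum_residues_eq_one hcard hX
  have key := weighted_mean_le X W _ _ a (div_nonneg hA' hA.le) (div_nonneg hB' hB.le) hW hsum
  have hprodW : (∏ x ∈ X, |(nodal Y id).eval x|) =
      (∏ x ∈ X, W x) * ((∏ x ∈ X, x) * (∏ x ∈ X, (1 - x)) * pairProd X) := by
    rw [pairProd, ← prod_mul_distrib, ← prod_mul_distrib, ← prod_mul_distrib]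
    refine prod_congr rfl fun x hx => ?_
    obtain ⟨h1, h2⟩ := hX x hx
    have hne : ∏ z ∈ X.erase x, |x - z| ≠ 0 :=
      prod_ne_zero_iff.2 fun z hz => abs_ne_zero.2 (sub_ne_zero.2 (ne_of_mem_erase hz).symm)
    rw [← abs_of_nonneg (hW x hx), hWdef]
    dsimp only
    rw [abs_div, abs_mul, abs_mul, abs_prod, abs_of_pos h1, abs_of_neg (sub_neg.2 h2), neg_sub]
    have : 1 - x ≠ 0 := (sub_pos.2 h2).ne'
    field_simp
  rw [pairProd_eq_of_derivative hder, hprodW]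
  simp only [prod_mul_distrib]
  rw [div_pow, div_pow] at key
  have hP := pairProd_pos X
  set A := ∏ x ∈ X, x
  set B := ∏ x ∈ X, (1 - x)
  set A' := ∏ y ∈ Y, y
  set B' := ∏ y ∈ Y, (1 - y)
  set V := ∏ x ∈ X, W x
  set T := ((2 * a + #X : ℕ) : ℝ) ^ (2 * a + #X)
  calc (A' * B') ^ a * ((#Y : ℝ) ^ #Y * (V * (A * B * pairProd X))) * T
      = (A' ^ a / A ^ a * (B' ^ a / B ^ a) * V * T) *
          ((#Y : ℝ) ^ #Y * ((A * B) ^ (a + 1) * pairProd X)) := by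
        field_simp
        ring
    _ ≤ (a : ℝ) ^ (2 * a) * ((#Y : ℝ) ^ #Y * ((A * B) ^ (a + 1) * pairProd X)) :=
        mul_le_mul_of_nonneg_right key (by positivity)
    _ = _ := by ring

/-- Iteration of `exists_pairProd_le` down to the empty set. The hypothesis `2 ≤ 2 * a + m` keeps
the denominators positive and is preserved, since `a` grows by one whenever `m` drops by one. -/
theorem pairProd_mul_le (m : ℕ) : ∀ (Y : Finset ℝ) (a : ℕ), #Y = m →
    (∀ y ∈ Y, y ∈ Set.Icc (0 : ℝ) 1) → 2 ≤ 2 * a + m →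
    (∏ y ∈ Y, y * (1 - y)) ^ a * pairProd Y ≤
      ∏ i ∈ range m, (((a + i : ℕ) : ℝ) ^ (2 * (a + i)) * ((m - i : ℕ) : ℝ) ^ (m - i) /
        ((2 * a + m + i - 1 : ℕ) : ℝ) ^ (2 * a + m + i - 1)) := by
  induction m with
  | zero =>
    intro Y a hY _ _
    rw [card_eq_zero.1 hY]
    simp [pairProd]
  | succ m ih =>
    intro Y a hY hI h2
    obtain ⟨X, hcard, hX, hle⟩ := exists_pairProd_le Y (card_pos.1 (by omega)) hI a
    have hXm : #X = m := by omega
    rw [hXm, hY] at hle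
    have hrec := ih X (a + 1) hXm hX (by omega)
    have hpos : (0 : ℝ) < ((2 * a + m : ℕ) : ℝ) ^ (2 * a + m) :=
      pow_pos (by exact_mod_cast (by omega : 0 < 2 * a + m)) _
    rw [prod_range_succ']
    rw [← le_div_iff₀ hpos] at hle
    refine hle.trans ?_
    rw [mul_div_right_comm, mul_comm]
    refine mul_le_mul (hrec.trans_eq (prod_congr rfl fun i _ => ?_)) (le_of_eq ?_)
      (by positivity) (prod_nonneg fun i _ => by positivity)
    · rw [show a + 1 + i = a + (i + 1) by ring, show m + 1 - (i + 1) = m - i by omega,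
        show 2 * (a + 1) + m + i - 1 = 2 * a + (m + 1) + (i + 1) - 1 by omega]
    · rw [show 2 * a + (m + 1) + 0 - 1 = 2 * a + m by omega, Nat.sub_zero, add_zero, mul_comm]

/-! ### The sieve constant -/

theorem sieveConst_pos {s : ℕ} (hs : 2 ≤ s) : 0 < sieveConst s := by
  refine prod_pos fun j hj => Real.rpow_pos_of_pos ?_ _
  obtain ⟨hj1, -⟩ := mem_Icc.1 hj
  have h1 : (0 : ℝ) < ((s + j - 2 : ℕ) : ℝ) := by exact_mod_cast (by omega : 0 < s + j - 2)
  have h2 : (0 : ℝ) < (j : ℝ) := by exact_mod_cast hj1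
  refine div_pos (mul_pos ?_ (pow_pos h2 _)) (pow_pos h1 _)
  rcases Nat.eq_zero_or_pos (j - 1) with h | h
  · simp [h]
  · exact pow_pos (by exact_mod_cast h) _

/-- The constants collected by `pairProd_mul_le` for `a = 0`, after reversing the order of the
factors `(s - i) ^ (s - i)`. -/
theorem sieveConst_pow {s : ℕ} (hs : 2 ≤ s) :
    sieveConst s ^ (s * (s - 1)) =
      ∏ i ∈ range s, ((i : ℝ) ^ (2 * i) * ((s - i : ℕ) : ℝ) ^ (s - i) /
        ((s + i - 1 : ℕ) : ℝ) ^ (s + i - 1)) := by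
  have hs0 : (s : ℝ) ≠ 0 := by exact_mod_cast (by omega : s ≠ 0)
  have hs1 : (s : ℝ) - 1 ≠ 0 := sub_ne_zero.2 (by exact_mod_cast (by omega : s ≠ 1))
  have hcast : ((s * (s - 1) : ℕ) : ℝ) = s * ((s : ℝ) - 1) := by
    rw [Nat.cast_mul, Nat.cast_sub (by omega), Nat.cast_one]
  have hrefl : ∏ i ∈ range s, ((s - i : ℕ) : ℝ) ^ (s - i) =
      ∏ i ∈ range s, ((i + 1 : ℕ) : ℝ) ^ (i + 1) := by
    rw [← prod_range_reflect]
    refine prod_congr rfl fun i hi => ?_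
    rw [show s - (s - 1 - i) = i + 1 by have := mem_range.1 hi; omega]
  rw [sieveConst, ← prod_pow, prod_div_distrib, prod_mul_distrib, hrefl, ← prod_mul_distrib,
    ← prod_div_distrib, ← Ico_add_one_right_eq_Icc, prod_Ico_eq_prod_range, Nat.add_sub_cancel]
  refine prod_congr rfl fun i _ => ?_
  rw [← Real.rpow_mul_natCast (by positivity), hcast,
    one_div_mul_cancel (mul_ne_zero hs0 hs1), Real.rpow_one, show 1 + i - 1 = i by omega,
    show s + (1 + i) - 2 = s + i - 1 by omega, add_comm 1 i]

/-- The sharp upper bound of Stieltjes and Schur for the discriminant of points in `[0, 1]`. -/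
theorem pairProd_le_sieveConst_pow (Y : Finset ℝ) (hs : 2 ≤ #Y)
    (hI : ∀ y ∈ Y, y ∈ Set.Icc (0 : ℝ) 1) :
    pairProd Y ≤ sieveConst #Y ^ (#Y * (#Y - 1)) := by
  have h := pairProd_mul_le #Y Y 0 rfl hI (by omega)
  rw [sieveConst_pow hs]
  simpa using h

/-! ### The larger sieve -/

theorem sum_log_abs_sub_le {N M : ℝ} (hM : 0 < M) (S : Finset ℤ)
    (hS : ∀ n ∈ S, (n : ℝ) ∈ Set.Icc N (N + M)) (hs : 2 ≤ #S) :
    ∑ m ∈ S, ∑ n ∈ S.erase m, Real.log |(m : ℝ) - n| ≤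
      #S * ((#S : ℝ) - 1) * Real.log (sieveConst #S * M) := by
  set f : ℤ → ℝ := fun n => ((n : ℝ) - N) / M with hf
  have hinj : Function.Injective f := fun m n h => by
    simpa [hf, div_left_inj' hM.ne'] using h
  have hcard : #(S.image f) = #S := card_image_of_injective _ hinj
  have h := pairProd_le_sieveConst_pow (S.image f) (hcard ▸ hs) (by
    simp only [mem_image, forall_exists_index, and_imp, forall_apply_eq_imp_iff₂]
    intro n hn
    obtain ⟨h1, h2⟩ := hS n hn
    exact ⟨div_nonneg (by linarith) hM.le, (div_le_one hM).2 (by linarith)⟩)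
  have hc := sieveConst_pos hs
  have hlog := Real.log_le_log (pairProd_pos _) h
  have hne {m n : ℤ} (hn : n ∈ S.erase m) : |(m : ℝ) - n| ≠ 0 :=
    abs_ne_zero.2 (sub_ne_zero.2 (by exact_mod_cast (ne_of_mem_erase hn).symm))
  have hfsub (m n : ℤ) : |f m - f n| = |(m : ℝ) - n| / M := by
    rw [hf, ← sub_div, abs_div, abs_of_pos hM, sub_sub_sub_cancel_right]
  have hlogeq : Real.log (pairProd (S.image f)) =
      ∑ m ∈ S, ∑ n ∈ S.erase m, (Real.log |(m : ℝ) - n| - Real.log M) := by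
    rw [pairProd, prod_image hinj.injOn, Real.log_prod]
    · refine sum_congr rfl fun m hm => ?_
      rw [← image_erase hinj, prod_image hinj.injOn, Real.log_prod]
      · refine sum_congr rfl fun n hn => ?_
        rw [hfsub, Real.log_div (hne hn) hM.ne']
      · intro n hn
        rw [hfsub]
        exact div_ne_zero (hne hn) hM.ne'
    · intro m hm
      rw [← image_erase hinj, prod_image hinj.injOn, prod_ne_zero_iff]
      intro n hn
      rw [hfsub]
      exact div_ne_zero (hne hn) hM.ne'
  have hconst : ∑ m ∈ S, ∑ n ∈ S.erase m, Real.log M = #S * ((#S : ℝ) - 1) * Real.log M := by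
    rw [sum_congr rfl fun m hm => by
      rw [sum_const, card_erase_of_mem hm, nsmul_eq_mul, Nat.cast_sub (by omega), Nat.cast_one]]
    rw [sum_const, nsmul_eq_mul, mul_assoc]
  rw [hlogeq, hcard, Real.log_pow, Nat.cast_mul, Nat.cast_sub (by omega), Nat.cast_one] at hlog
  simp only [sum_sub_distrib] at hlog
  rw [hconst] at hlog
  rw [Real.log_mul hc.ne' hM.ne']
  linarith

/-- Pairs of elements of `S`, the diagonal included, with the same image under `f`: by
Cauchy-Schwarz there are at least `#S ^ 2 / k` of them if `f` takes at most `k` values on `S`. -/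
theorem card_sq_le_mul_sum_card_fiber {α β : Type*} [DecidableEq β] (S : Finset α)
    (f : α → β) {k : ℕ} (hk : #(S.image f) ≤ k) :
    #S ^ 2 ≤ k * ∑ m ∈ S, #{n ∈ S | f n = f m} := by
  rw [sum_comp (fun b => #{n ∈ S | f n = b}) f]
  calc #S ^ 2 = (∑ b ∈ S.image f, #{n ∈ S | f n = b}) ^ 2 := by rw [← card_eq_sum_card_image]
    _ ≤ #(S.image f) * ∑ b ∈ S.image f, #{n ∈ S | f n = b} ^ 2 := sq_sum_le_card_mul_sum_sq
    _ ≤ _ := by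
      simp only [smul_eq_mul, sq]
      exact Nat.mul_le_mul_right _ hk

theorem sum_log_le_log_abs_sub {Q : Finset ℕ} (hQ : (Q : Set ℕ).Pairwise Nat.Coprime)
    (hQ0 : ∀ q ∈ Q, 1 ≤ q) {m n : ℤ} (hmn : m ≠ n) :
    ∑ q ∈ Q with ((n : ZMod q) = (m : ZMod q)), Real.log q ≤ Real.log |(m : ℝ) - n| := by
  rw [← Real.log_prod fun q hq => by
    have := hQ0 q (mem_filter.1 hq).1
    positivity]
  have hdvd : (∏ q ∈ Q with ((n : ZMod q) = (m : ZMod q)), (q : ℤ)) ∣ |m - n| := by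
    refine Finset.prod_dvd_of_coprime (fun p hp q hq hpq => ?_) fun q hq => ?_
    · exact Nat.isCoprime_iff_coprime.2
        (hQ (mem_filter.1 hp).1 (mem_filter.1 hq).1 hpq)
    · exact (dvd_abs _ _).2 ((ZMod.intCast_eq_intCast_iff_dvd_sub _ _ _).1 (mem_filter.1 hq).2)
  have hle := Int.le_of_dvd (abs_pos.2 (sub_ne_zero.2 hmn)) hdvd
  refine Real.log_le_log (prod_pos fun q hq => ?_) (by simpa using (Int.cast_le (R := ℝ)).2 hle)
  exact_mod_cast hQ0 q (mem_filter.1 hq).1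

/-- Gallagher's larger sieve inequality: each difference of two elements of `S` is divisible by the
product of the moduli for which it vanishes. -/
theorem sum_log_mul_le_sum_log_abs_sub (S : Finset ℤ) {Q : Finset ℕ}
    (hQ : (Q : Set ℕ).Pairwise Nat.Coprime) (ν : ℕ → ℕ) (hν : ∀ q ∈ Q, 1 ≤ ν q ∧ ν q ≤ q)
    (hclasses : ∀ q ∈ Q, #(S.image (fun n : ℤ => (n : ZMod q))) ≤ ν q) :
    ∑ q ∈ Q, Real.log q * ((#S : ℝ) ^ 2 / ν q - #S) ≤
      ∑ m ∈ S, ∑ n ∈ S.erase m, Real.log |(m : ℝ) - n| := by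
  calc ∑ q ∈ Q, Real.log q * ((#S : ℝ) ^ 2 / ν q - #S)
      ≤ ∑ q ∈ Q, Real.log q *
          ∑ m ∈ S, ∑ n ∈ S.erase m, if (n : ZMod q) = (m : ZMod q) then (1 : ℝ) else 0 := by
        refine sum_le_sum fun q hq =>
          mul_le_mul_of_nonneg_left ?_ (Real.log_natCast_nonneg q)
        have hν0 : (0 : ℝ) < ν q := by exact_mod_cast (hν q hq).1
        have h : (#S : ℝ) ^ 2 ≤ ν q * ∑ m ∈ S, (#{n ∈ S | ((n : ℤ) : ZMod q) = (m : ZMod q)} : ℝ) := by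
          exact_mod_cast card_sq_le_mul_sum_card_fiber S (fun n : ℤ => (n : ZMod q))
            (hclasses q hq)
        have h2 : ∑ m ∈ S, (#{n ∈ S | ((n : ℤ) : ZMod q) = (m : ZMod q)} : ℝ) = #S +
            ∑ m ∈ S, ∑ n ∈ S.erase m, if (n : ZMod q) = (m : ZMod q) then (1 : ℝ) else 0 := by
          rw [card_eq_sum_ones, Nat.cast_sum, ← sum_add_distrib]
          refine sum_congr rfl fun m hm => ?_
          rw [← sum_boole, ← add_sum_erase _ _ hm]
          simp
        rw [h2] at h
        rw [sub_le_iff_le_add, div_le_iff₀ hν0]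
        linarith
    _ = ∑ m ∈ S, ∑ n ∈ S.erase m,
          ∑ q ∈ Q with ((n : ZMod q) = (m : ZMod q)), Real.log q := by
        simp only [mul_sum, mul_ite, mul_one, mul_zero, sum_filter]
        rw [sum_comm]
        exact sum_congr rfl fun m _ => sum_comm
    _ ≤ _ := sum_le_sum fun m _ => sum_le_sum fun n hn =>
        sum_log_le_log_abs_sub hQ (fun q hq => (hν q hq).1.trans (hν q hq).2)
          (ne_of_mem_erase hn).symm

theorem theorem1 (N M : ℝ) (hM : 0 < M)
    (S : Finset ℤ) (hS : ∀ n ∈ S, (n : ℝ) ∈ Set.Icc N (N + M))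
    (Q : Finset ℕ) (hQ : (Q : Set ℕ).Pairwise Nat.Coprime)
    (ν : ℕ → ℕ) (hν : ∀ q ∈ Q, 1 ≤ ν q ∧ ν q ≤ q)
    (hclasses : ∀ q ∈ Q, (S.image (fun n : ℤ => (n : ZMod q))).card ≤ ν q)
    (hpos : 0 < (∑ q ∈ Q, Real.log q / ν q) - Real.log (sieveConst S.card * M)) :
    (S.card : ℝ) ≤
      ((∑ q ∈ Q, Real.log q) - Real.log (sieveConst S.card * M)) /
        ((∑ q ∈ Q, Real.log q / ν q) - Real.log (sieveConst S.card * M)) := by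
  rw [le_div_iff₀ hpos]
  rcases Nat.lt_or_ge #S 2 with hs | hs
  · have hle : ∑ q ∈ Q, Real.log q / ν q ≤ ∑ q ∈ Q, Real.log q := sum_le_sum fun q hq =>
      div_le_self (Real.log_natCast_nonneg q) (by exact_mod_cast (hν q hq).1)
    have h1 : (#S : ℝ) ≤ 1 := by exact_mod_cast (by omega : #S ≤ 1)
    nlinarith [mul_le_mul_of_nonneg_right h1 hpos.le]
  · have h := (sum_log_mul_le_sum_log_abs_sub S hQ ν hν hclasses).trans
      (sum_log_abs_sub_le hM S hS hs)
    have hs0 : (0 : ℝ) < #S := by exact_mod_cast (by omega : 0 < #S)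
    have hsplit : ∑ q ∈ Q, Real.log q * ((#S : ℝ) ^ 2 / ν q - #S) =
        #S * (#S * ∑ q ∈ Q, Real.log q / ν q - ∑ q ∈ Q, Real.log q) := by
      simp only [mul_sum, ← sum_sub_distrib]
      exact sum_congr rfl fun q _ => by ring
    rw [hsplit, mul_assoc] at h
    linarith [le_of_mul_le_mul_left h hs0]
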